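/- Let $(\Sigma,D)$ be a dependence alphabet, i.e. $\Sigma$ is a finite set of letters and $D\subseteq\Sigma\times\Sigma$ is reflexive and symmetric. Two letters are independent if they are distinct and $(a,b)\notin D$. Let $\mathbb M=\Sigma^*/{\sim}$ be the trace monoid, where $\sim$ is the least monoid congruence with $ab\sim ba$ for all independent $a,b$, and let $[w]$ denote the trace induced by the word $w$. A trace language $\mathcal K\subseteq\mathbb M$ is recognizable if the word language $\{w\in\Sigma^*\mid [w]\in\mathcal K\}$ is regular. Let $\mathcal F$ be the set of all sets $A\subseteq\Sigma$ of pairwise independent letters (including $\emptyset$); for $A=\{a_1,\dots,a_m\}\in\mathcal F$ with $a_1,\dots,a_m$ distinct, let $[A]=[a_1\cdots a_m]$, and extend this to a homomorphism $[\cdot]\colon\mathcal F^*\to\mathbb M$. A word $A_1A_2\cdots A_n\in\mathcal F^*$ is in extended Foata normal form if for all $1\le i<n$ and $b\in A_{i+1}$ there is $a\in A_i$ with $(a,b)\in D$. For $\mathcal R\subseteq\mathbb M^2$, let $L_{\mathcal R}\subseteq(\mathcal F^2)^*$ be the set of all words $(A_1,C_1)(A_2,C_2)\cdots(A_n,C_n)$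 such that $A_1\cdots A_n$ and $C_1\cdots C_n$ are in extended Foata normal form and $([A_1\cdots A_n],[C_1\cdots C_n])\in\mathcal R$. The relation $\mathcal R$ is fnf-automatic if $L_{\mathcal R}$ is regular. Lemma. Let $\mathcal R\subseteq\mathbb M^2$ be fnf-automatic and let $\mathcal K,\mathcal L\subseteq\mathbb M$ be recognizable. Then \[ \mathcal R\cdot(\mathcal K\times\mathcal L)=\{(x_1y,x_2z)\mid (x_1,x_2)\in\mathcal R,\ y\in\mathcal K,\ z\in\mathcal L\} \] is effectively fnf-automatic. That is, it is fnf-automatic, and there is an algorithm that, given $(\Sigma,D)$ (with $\Sigma=\{0,\dots,n-1\}$), an NFA for $L_{\mathcal R}$, and NFAs for $\{w\mid[w]\in\mathcal K\}$ and $\{w\mid[w]\in\mathcal L\}$, computes an NFA for $L_{\mathcal R\cdot(\mathcal K\times\mathcal L)}$. -/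

import Mathlib

namespace FoataTrace

universe u

/-- A dependence relation on an alphabet `α`: a reflexive and symmetric relation.  A dependence
alphabet is a finite type `α` together with such a relation. -/
structure Dependence (α : Type u) where
  /-- `D.Dep a b` means `(a, b) ∈ D`. -/
  Dep : α → α → Prop
  refl : ∀ a, Dep a a
  symm : ∀ a b, Dep a b → Dep b a

namespace Dependence

variable {α : Type u} (D : Dependence α)

/-- The independence relation: distinct letters that are not dependent. -/
def Indep (a b : α) : Prop := a ≠ b ∧ ¬ D.Dep a b

/-- The defining relations `ab = ba` of the trace monoid, for independent `a` and `b`. -/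
def commRel (u v : FreeMonoid α) : Prop :=
  ∃ a b, D.Indep a b ∧ u = FreeMonoid.of a * FreeMonoid.of b ∧
    v = FreeMonoid.of b * FreeMonoid.of a

/-- The trace monoid: the quotient of the free monoid by the least congruence with `ab ∼ ba`
for independent letters `a` and `b`. -/
abbrev Trace : Type u := PresentedMonoid D.commRel

/-- The trace `[w]` induced by the word `w`. -/
def traceOfWord (w : List α) : D.Trace := PresentedMonoid.mk D.commRel (FreeMonoid.ofList w)

/-- The language of all words that induce a trace in `K`. -/
def wordLanguage (K : Set D.Trace) : Language α := {w | D.traceOfWord w ∈ K}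

/-- A trace language is recognizable if the set of all words inducing one of its elements is a
regular language. -/
def IsRecognizable (K : Set D.Trace) : Prop := (D.wordLanguage K).IsRegular

/-- The set `𝓕` of independent sets of letters (including the empty set). -/
def IndepSet : Type u := {A : Finset α // (A : Set α).Pairwise D.Indep}

theorem commute_of_indep {a b : α} (h : D.Indep a b) :
    Commute (D.traceOfWord [a]) (D.traceOfWord [b]) :=
  PresentedMonoid.mk_eq_mk_of_rel (rels := D.commRel) ⟨a, b, h, rfl, rfl⟩

/-- The trace `[A]` of an independent set `A`: the product of its letters, in any order. -/
def traceOfSet (A : D.IndepSet) : D.Trace :=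
  A.1.noncommProd (fun a => D.traceOfWord [a])
    (fun _ ha _ hb hab => D.commute_of_indep (A.2 ha hb hab))

/-- The extension of `A ↦ [A]` to a homomorphism on words over `𝓕`. -/
def traceOfSets (W : List D.IndepSet) : D.Trace := (W.map D.traceOfSet).prod

/-- `A₁ A₂ ⋯ Aₙ` is in extended Foata normal form if every letter in `Aᵢ₊₁` depends on some
letter in `Aᵢ`, for all `1 ≤ i < n`. -/
def IsExtFoata (W : List D.IndepSet) : Prop :=
  W.IsChain (fun A B => ∀ b ∈ B.1, ∃ a ∈ A.1, D.Dep a b)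

/-- The language `L_R` over the alphabet `𝓕 × 𝓕`: all words whose two components are in extended
Foata normal form and represent a pair of traces in `R`. -/
def foataLanguage (R : Set (D.Trace × D.Trace)) : Language (D.IndepSet × D.IndepSet) :=
  {W | D.IsExtFoata (W.map Prod.fst) ∧ D.IsExtFoata (W.map Prod.snd) ∧
    (D.traceOfSets (W.map Prod.fst), D.traceOfSets (W.map Prod.snd)) ∈ R}

/-- A binary trace relation `R` is fnf-automatic if the language `L_R` is regular. -/
def IsFnfAutomatic (R : Set (D.Trace × D.Trace)) : Prop := (D.foataLanguage R).IsRegular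

/-- The product `R · (K × L)`. -/
def mulProd (R : Set (D.Trace × D.Trace)) (K L : Set D.Trace) : Set (D.Trace × D.Trace) :=
  {p | ∃ x₁ x₂ y z, (x₁, x₂) ∈ R ∧ y ∈ K ∧ z ∈ L ∧ p = (x₁ * y, x₂ * z)}

end Dependence

/-! ### Finite presentations, as inputs and outputs of algorithms -/

/-- A finite description of an NFA: the list of initial states, the list of transitions
`(p, b, q)` with `b` describing a letter, and the list of final states.  States are natural
numbers, of which only finitely many occur. -/
abbrev NFACode (β : Type) : Type := List ℕ × List (ℕ × β × ℕ) × List ℕ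

namespace NFACode

variable {β : Type} {α : Type u}

/-- The automaton over the alphabet `α` described by a code, where `r b a` means that `b`
describes the letter `a`. -/
def toNFA (r : β → α → Prop) (c : NFACode β) : NFA α ℕ where
  step p a := {q | ∃ b, r b a ∧ (p, b, q) ∈ c.2.1}
  start := {p | p ∈ c.1}
  accept := {p | p ∈ c.2.2}

/-- The code `c` describes an NFA over the alphabet `α` (every transition is labelled by a
letter) that accepts the language `L`. -/
def Presents (r : β → α → Prop) (c : NFACode β) (L : Language α) : Prop :=
  (∀ t ∈ c.2.1, ∃ a, r t.2.1 a) ∧ (c.toNFA r).accepts = L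

end NFACode

/-- The number `b` describes the letter `a` of the alphabet `Fin n`. -/
def DescribesLetter {n : ℕ} (b : ℕ) (a : Fin n) : Prop := b = a

/-- The pair `b` of lists of numbers describes the pair `A` of independent sets: the lists
enumerate, in any order, the elements of the two sets. -/
def DescribesSets {n : ℕ} (D : Dependence (Fin n)) (b : List ℕ × List ℕ)
    (A : D.IndepSet × D.IndepSet) : Prop :=
  b.1.toFinset = A.1.1.map Fin.valEmbedding ∧ b.2.toFinset = A.2.1.map Fin.valEmbedding

/-- The list `d` of pairs of numbers describes the dependence relation `D`. -/
def DescribesDependence {n : ℕ} (d : List (ℕ × ℕ)) (D : Dependence (Fin n)) : Prop :=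
  ∀ a b : Fin n, D.Dep a b ↔ ((a : ℕ), (b : ℕ)) ∈ d

end FoataTrace

open FoataTrace

/-!
If the trace with extended Foata normal form `A₁ ⋯ Aₙ` is a product `x y`, then by Levi's lemma
every layer splits into a part `Bᵢ ⊆ Aᵢ` belonging to `x` and the rest belonging to `y`, and the
letters of `Aᵢ \ Bᵢ` are independent of all letters of `Bᵢ₊₁, …, Bₙ`.  Hence a letter of `Aᵢ` on
which some letter of `Bᵢ₊₁` depends lies in `Bᵢ`, so `B₁ ⋯ Bₙ` is an extended normal form of `x`
of the same length `n`, where trailing layers may be empty.  Therefore `L_{R · (K × L)}` is a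
length-preserving composition of `L_R` with the languages of all splittings whose right factor
lies in `K` or in `L`, and an automaton recognizes the latter by remembering the last layer, the
letters left out so far and a state of an automaton for the word language of `K` or `L`.
-/

namespace FoataTrace

/-- For length-preserving relations, viewed as languages of pairs of words of equal length, the
composition of `L` with the converse of `L'`. -/
def compConverse {β γ δ : Type*} (L : Language (β × γ)) (L' : Language (δ × γ)) :
    Language (β × δ) :=
  {W | ∃ w : List γ, w.length = W.length ∧ (W.map Prod.fst).zip w ∈ L ∧
    (W.map Prod.snd).zip w ∈ L'}

namespace Dependence

variable {α : Type u} {D : Dependence α}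

/-! ### Traces and their letters -/

theorem Indep.symm {a b : α} (h : D.Indep a b) : D.Indep b a :=
  ⟨h.1.symm, fun hba => h.2 (D.symm b a hba)⟩

theorem indep_iff_not_dep {a b : α} : D.Indep a b ↔ ¬D.Dep a b :=
  ⟨fun h => h.2, fun h => ⟨fun hab => h (hab ▸ D.refl a), h⟩⟩

theorem traceOfWord_append (u v : List α) :
    D.traceOfWord (u ++ v) = D.traceOfWord u * D.traceOfWord v := rfl

theorem traceOfWord_eq_prod (w : List α) :
    D.traceOfWord w = (w.map fun a => D.traceOfWord [a]).prod := by
  induction w with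
  | nil => rfl
  | cons a w ih =>
    rw [List.map_cons, List.prod_cons, ← ih, ← traceOfWord_append, List.singleton_append]

theorem trace_induction {P : D.Trace → Prop} (one : P 1)
    (letter_mul : ∀ a t, P t → P (D.traceOfWord [a] * t)) (t : D.Trace) : P t := by
  induction t using PresentedMonoid.inductionOn with | _ w
  change P (D.traceOfWord w.toList)
  induction w.toList with
  | nil => exact one
  | cons a w ih => exact letter_mul a _ ih

section Lift

variable {N : Type*} [Monoid N] (f : α → N) (hf : ∀ a b, D.Indep a b → Commute (f a) (f b))

/-- The homomorphism from the trace monoid to a monoid `N` that extends a map on letters sending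
independent letters to commuting elements. -/
def liftTrace : D.Trace →* N :=
  PresentedMonoid.lift f <| by
    rintro _ _ ⟨a, b, h, rfl, rfl⟩
    simpa only [map_mul, FreeMonoid.lift_eval_of] using (hf a b h).eq

end Lift

/-- The letters of a trace, with their multiplicities. -/
def letters (t : D.Trace) : Multiset α :=
  (liftTrace (fun a => Multiplicative.ofAdd {a}) (fun _ _ _ => Commute.all _ _) t).toAdd

theorem letters_one : letters (1 : D.Trace) = 0 := rfl

theorem letters_letter (a : α) : letters (D.traceOfWord [a]) = {a} := rfl

theorem letters_mul (x y : D.Trace) : letters (x * y) = letters x + letters y := by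
  rw [letters, map_mul, toAdd_mul, letters, letters]

theorem mem_letters_letter_mul {a b : α} {x : D.Trace} :
    b ∈ letters (D.traceOfWord [a] * x) ↔ b = a ∨ b ∈ letters x := by
  rw [letters_mul, letters_letter, Multiset.mem_add, Multiset.mem_singleton]

theorem commute_of_indep_letters {x y : D.Trace}
    (h : ∀ a ∈ letters x, ∀ b ∈ letters y, D.Indep a b) : Commute x y := by
  induction x using trace_induction with
  | one => exact Commute.one_left y
  | letter_mul a x ihx =>
    refine .mul_left ?_ (ihx fun b hb => h b (mem_letters_letter_mul.2 (.inr hb)))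
    replace h := h a (mem_letters_letter_mul.2 (.inl rfl))
    clear ihx
    induction y using trace_induction with
    | one => exact Commute.one_right _
    | letter_mul b y ihy =>
      exact .mul_right (D.commute_of_indep (h b (mem_letters_letter_mul.2 (.inl rfl))))
        (ihy fun c hc => h c (mem_letters_letter_mul.2 (.inr hc)))

/-! ### Factorizations of a trace -/

/-- The factorizations of `[a] t` obtained from the set `Z` of factorizations of `t`: the new
letter goes to the front of the left factor or, if it is independent of all letters of the left
factor, to the front of the right one. -/
def consFactorizations (a : α) (Z : Set (D.Trace × D.Trace)) : Set (D.Trace × D.Trace) :=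
  {p | (∃ x', p.1 = D.traceOfWord [a] * x' ∧ (x', p.2) ∈ Z) ∨
    ∃ y', p.2 = D.traceOfWord [a] * y' ∧ (p.1, y') ∈ Z ∧ ∀ b ∈ letters p.1, D.Indep a b}

theorem consFactorizations_comm_subset {a b : α} (h : D.Indep a b)
    (Z : Set (D.Trace × D.Trace)) :
    consFactorizations a (consFactorizations b Z) ⊆
      consFactorizations b (consFactorizations a Z) := by
  have hcomm (t : D.Trace) : D.traceOfWord [a] * (D.traceOfWord [b] * t) =
      D.traceOfWord [b] * (D.traceOfWord [a] * t) := (D.commute_of_indep h).left_comm t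
  rintro ⟨x, y⟩ (⟨x, rfl, ⟨x, rfl, hZ⟩ | ⟨y, rfl, hZ, hb⟩⟩ |
    ⟨y, rfl, ⟨x, rfl, hZ⟩ | ⟨y, rfl, hZ, hb⟩, ha⟩)
  · exact .inl ⟨_, hcomm x, .inl ⟨x, rfl, hZ⟩⟩
  · refine .inr ⟨y, rfl, .inl ⟨x, rfl, hZ⟩, fun c hc => ?_⟩
    obtain rfl | hc := mem_letters_letter_mul.1 hc
    exacts [h.symm, hb c hc]
  · exact .inl ⟨x, rfl, .inr ⟨y, rfl, hZ, fun c hc => ha c (mem_letters_letter_mul.2 (.inr hc))⟩⟩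
  · exact .inr ⟨_, hcomm y, .inr ⟨y, rfl, hZ, ha⟩, hb⟩

/-- The action of a trace `t` on sets of factorizations by `consFactorizations`.  Started from the
single factorization `(1, 1)` of the empty trace, it computes the pairs `(x, y)` with
`x * y = t`. -/
def prependFactorizations : D.Trace →* Function.End (Set (D.Trace × D.Trace)) :=
  liftTrace consFactorizations fun _ _ h => funext fun Z =>
    (consFactorizations_comm_subset h Z).antisymm (consFactorizations_comm_subset h.symm Z)

theorem prependFactorizations_letter_mul (a : α) (t : D.Trace) (Z : Set (D.Trace × D.Trace)) :
    prependFactorizations (D.traceOfWord [a] * t) Z =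
      consFactorizations a (prependFactorizations t Z) := by
  rw [map_mul]
  rfl

theorem mem_prependFactorizations {t x y : D.Trace} :
    (x, y) ∈ prependFactorizations t {(1, 1)} ↔ x * y = t := by
  constructor
  · induction t using trace_induction generalizing x y with
    | one =>
      rintro ⟨⟩
      exact one_mul 1
    | letter_mul a t ih =>
      rw [prependFactorizations_letter_mul]
      rintro (⟨x', rfl : x = _, h⟩ | ⟨y', rfl : y = _, h, ha⟩)
      · rw [mul_assoc, ih h]
      · have hcomm : Commute (D.traceOfWord [a]) x :=
          commute_of_indep_letters <| by simpa [letters_letter] using ha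
        rw [← hcomm.left_comm, ih h]
  · rintro rfl
    induction x using trace_induction with
    | one =>
      rw [one_mul]
      induction y using trace_induction with
      | one => rfl
      | letter_mul a y ih =>
        rw [prependFactorizations_letter_mul]
        exact .inr ⟨y, rfl, ih, by simp [letters_one]⟩
    | letter_mul a x ih =>
      rw [mul_assoc, prependFactorizations_letter_mul]
      exact .inl ⟨x, rfl, ih⟩

/-- Levi's lemma for a letter on one side. -/
theorem letter_mul_eq_mul {a : α} {t x y : D.Trace} (h : D.traceOfWord [a] * t = x * y) :
    (∃ x', x = D.traceOfWord [a] * x' ∧ t = x' * y) ∨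
      ∃ y', y = D.traceOfWord [a] * y' ∧ t = x * y' ∧ ∀ b ∈ letters x, D.Indep a b := by
  have hmem := mem_prependFactorizations.2 h.symm
  rw [prependFactorizations_letter_mul] at hmem
  obtain ⟨x', hx, hZ⟩ | ⟨y', hy, hZ, ha⟩ := hmem
  · exact .inl ⟨x', hx, (mem_prependFactorizations.1 hZ).symm⟩
  · exact .inr ⟨y', hy, (mem_prependFactorizations.1 hZ).symm, ha⟩

/-! ### Layers -/

/-- The independent set `A \ B`. -/
def IndepSet.sdiff [DecidableEq α] (A B : D.IndepSet) : D.IndepSet :=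
  ⟨A.1 \ B.1, A.2.mono (by simpa only [Finset.coe_subset] using Finset.sdiff_subset)⟩

theorem traceOfSet_eq_mul_sdiff [DecidableEq α] {A B : D.IndepSet} (h : B.1 ⊆ A.1) :
    D.traceOfSet A = D.traceOfSet B * D.traceOfSet (A.sdiff B) := by
  rw [traceOfSet, traceOfSet, traceOfSet]
  simp only [IndepSet.sdiff]
  rw [← Finset.noncommProd_union_of_disjoint Finset.disjoint_sdiff]
  exact Finset.noncommProd_congr (Finset.union_sdiff_of_subset h).symm (fun _ _ => rfl) _

theorem traceOfSet_insert [DecidableEq α] {a : α} {A : Finset α} (ha : a ∉ A)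
    (h : ((insert a A : Finset α) : Set α).Pairwise D.Indep) :
    D.traceOfSet ⟨insert a A, h⟩ =
      D.traceOfWord [a] * D.traceOfSet ⟨A, h.mono (by simp)⟩ :=
  Finset.noncommProd_insert_of_notMem _ _ _ _ ha

theorem traceOfSet_eq_traceOfWord_sort [LinearOrder α] (A : D.IndepSet) :
    D.traceOfSet A = D.traceOfWord A.1.sort := by
  rw [traceOfWord_eq_prod, traceOfSet,
    ← Finset.noncommProd_toFinset _ _ _ (Finset.sort_nodup A.1 (· ≤ ·))]
  exact Finset.noncommProd_congr (Finset.sort_toFinset A.1 _).symm (fun _ _ => rfl) _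

theorem letters_traceOfSet (A : D.IndepSet) : letters (D.traceOfSet A) = A.1.val := by
  classical
  obtain ⟨A, hA⟩ := A
  induction A using Finset.induction_on with
  | empty => rfl
  | insert a A ha ih =>
    rw [traceOfSet_insert ha, letters_mul, letters_letter, ih, Multiset.singleton_add,
      Finset.insert_val_of_notMem ha]

theorem mem_letters_traceOfSet_mul {A : D.IndepSet} {b : α} {x : D.Trace} :
    b ∈ letters (D.traceOfSet A * x) ↔ b ∈ A.1 ∨ b ∈ letters x := by
  rw [letters_mul, letters_traceOfSet, Multiset.mem_add, Finset.mem_val]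

/-- Levi's lemma for an independent set on one side. -/
theorem exists_of_traceOfSet_mul_eq_mul [DecidableEq α] {A : D.IndepSet} {t x y : D.Trace}
    (h : D.traceOfSet A * t = x * y) :
    ∃ B : D.IndepSet, B.1 ⊆ A.1 ∧ ∃ x' y', x = D.traceOfSet B * x' ∧
      y = D.traceOfSet (A.sdiff B) * y' ∧ t = x' * y' ∧
      ∀ a ∈ A.1 \ B.1, ∀ b ∈ letters x', D.Indep a b := by
  obtain ⟨A, hA⟩ := A
  induction A using Finset.induction_on generalizing x y with
  | empty =>
    exact ⟨⟨∅, hA⟩, subset_rfl, x, y, (one_mul x).symm, (one_mul y).symm,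
      (one_mul t).symm.trans h, by simp⟩
  | insert a A ha ih =>
    have hA' : (A : Set α).Pairwise D.Indep := hA.mono (by simp)
    rw [traceOfSet_insert ha, mul_assoc] at h
    obtain ⟨x₁, rfl, hA't⟩ | ⟨y₁, rfl, hA't, hax⟩ := letter_mul_eq_mul h
    · obtain ⟨⟨B, hB⟩, hBA, x', y', rfl, rfl, ht, hind⟩ := ih hA' hA't
      have haB : a ∉ B := fun haB => ha (hBA haB)
      have hsdiff : insert a A \ insert a B = A \ B := by grind
      refine ⟨⟨insert a B, hA.mono (by simpa using Set.insert_subset_insert hBA)⟩,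
        Finset.insert_subset_insert a hBA, x', y', ?_, ?_, ht, by rwa [hsdiff]⟩
      · rw [traceOfSet_insert haB, mul_assoc]
      · simp only [IndepSet.sdiff, hsdiff]
    · obtain ⟨⟨B, hB⟩, hBA, x', y', rfl, rfl, ht, hind⟩ := ih hA' hA't
      have haB : a ∉ B := fun haB => ha (hBA haB)
      have hsdiff : insert a A \ B = insert a (A \ B) := Finset.insert_sdiff_of_notMem A haB
      refine ⟨⟨B, hB⟩, hBA.trans (Finset.subset_insert a A), x', y', rfl, ?_, ht, ?_⟩
      · simp only [IndepSet.sdiff, hsdiff]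
        rw [traceOfSet_insert (by grind), mul_assoc]
      · rw [hsdiff, Finset.forall_mem_insert]
        exact ⟨fun b hb => hax b (mem_letters_traceOfSet_mul.2 (.inr hb)), hind⟩

theorem traceOfSets_nil : D.traceOfSets [] = 1 := rfl

theorem traceOfSets_cons (A : D.IndepSet) (W : List D.IndepSet) :
    D.traceOfSets (A :: W) = D.traceOfSet A * D.traceOfSets W := by
  rw [traceOfSets, List.map_cons, List.prod_cons, traceOfSets]

theorem mem_letters_traceOfSets {W : List D.IndepSet} {b : α} :
    b ∈ letters (D.traceOfSets W) ↔ ∃ A ∈ W, b ∈ A.1 := by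
  induction W with
  | nil => simp [traceOfSets_nil, letters_one]
  | cons A W ih => simp [traceOfSets_cons, mem_letters_traceOfSet_mul, ih]

theorem zip_mem_foataLanguage {R : Set (D.Trace × D.Trace)} {v w : List D.IndepSet}
    (hlen : w.length = v.length) : v.zip w ∈ D.foataLanguage R ↔
      D.IsExtFoata v ∧ D.IsExtFoata w ∧ (D.traceOfSets v, D.traceOfSets w) ∈ R := by
  change _ ∧ _ ∧ _ ↔ _
  rw [List.map_fst_zip hlen.ge, List.map_snd_zip hlen.le]

/-! ### Splitting a Foata normal form -/

/-- A word `(A₁, B₁) ⋯ (Aₙ, Bₙ)` encodes a factorization of the trace with normal form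
`A₁ ⋯ Aₙ`, the left factor being `[B₁ ⋯ Bₙ]` and the right one `[A₁ \ B₁] ⋯ [Aₙ \ Bₙ]`: a letter
left out of the left factor is independent of all letters taken into it later on. -/
structure IsSplitting [DecidableEq α] (V : List (D.IndepSet × D.IndepSet)) : Prop where
  isExtFoata : D.IsExtFoata (V.map Prod.fst)
  subset : ∀ P ∈ V, P.2.1 ⊆ P.1.1
  indep : V.Pairwise fun P Q => ∀ a ∈ P.1.1 \ P.2.1, ∀ b ∈ Q.2.1, D.Indep a b

/-- The right factor encoded by a splitting. -/
def rightFactor [DecidableEq α] (V : List (D.IndepSet × D.IndepSet)) : D.Trace :=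
  D.traceOfSets (V.map fun P => P.1.sdiff P.2)

section Splitting

variable [DecidableEq α] {V : List (D.IndepSet × D.IndepSet)}

theorem isSplitting_of_cons {P : D.IndepSet × D.IndepSet} (h : IsSplitting (P :: V)) :
    IsSplitting V :=
  ⟨h.isExtFoata.tail, fun Q hQ => h.subset Q (List.mem_cons_of_mem P hQ),
    (List.pairwise_cons.1 h.indep).2⟩

theorem isExtFoata_map_snd (h : IsSplitting V) : D.IsExtFoata (V.map Prod.snd) := by
  have hdep := List.isChain_iff_getElem.1 ((List.isChain_map _).1 h.isExtFoata)
  have hind := List.isChain_iff_getElem.1 h.indep.isChain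
  rw [IsExtFoata, List.isChain_map, List.isChain_iff_getElem]
  intro i hi b hb
  obtain ⟨a, ha, hab⟩ := hdep i hi b (h.subset _ (List.getElem_mem _) hb)
  refine ⟨a, by_contra fun haB => ?_, hab⟩
  exact (hind i hi a (Finset.mem_sdiff.2 ⟨ha, haB⟩) b hb).2 hab

theorem traceOfSets_map_fst (h : IsSplitting V) : D.traceOfSets (V.map Prod.fst) =
    D.traceOfSets (V.map Prod.snd) * rightFactor V := by
  induction V with
  | nil => exact (one_mul 1).symm
  | cons P V ih =>
    have hcomm : Commute (D.traceOfSet (P.1.sdiff P.2)) (D.traceOfSets (V.map Prod.snd)) := by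
      refine commute_of_indep_letters fun a ha b hb => ?_
      rw [letters_traceOfSet] at ha
      obtain ⟨_, hB, hbQ⟩ := mem_letters_traceOfSets.1 hb
      obtain ⟨Q, hQ, rfl⟩ := List.mem_map.1 hB
      exact (List.pairwise_cons.1 h.indep).1 Q hQ a ha b hbQ
    simp only [rightFactor, List.map_cons, traceOfSets_cons] at ih ⊢
    rw [ih (isSplitting_of_cons h), traceOfSet_eq_mul_sdiff (h.subset P List.mem_cons_self),
      hcomm.mul_mul_mul_comm]

theorem exists_isSplitting {W : List D.IndepSet} {x y : D.Trace} (hW : D.IsExtFoata W)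
    (h : D.traceOfSets W = x * y) :
    ∃ V, IsSplitting V ∧ V.map Prod.fst = W ∧ D.traceOfSets (V.map Prod.snd) = x ∧
      rightFactor V = y := by
  induction W generalizing x y with
  | nil =>
    obtain ⟨rfl, rfl⟩ := Prod.ext_iff.1 (mem_prependFactorizations.2 h.symm)
    exact ⟨[], ⟨List.isChain_nil, by simp, .nil⟩, rfl, rfl, rfl⟩
  | cons A W ih =>
    rw [traceOfSets_cons] at h
    obtain ⟨B, hBA, x', y', rfl, rfl, hxy, hind⟩ := exists_of_traceOfSet_mul_eq_mul h
    obtain ⟨V, hV, rfl, rfl, rfl⟩ := ih hW.tail hxy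
    refine ⟨(A, B) :: V, ⟨hW, List.forall_mem_cons.2 ⟨hBA, hV.subset⟩,
      List.pairwise_cons.2 ⟨fun Q hQ a ha b hb => hind a ha b ?_, hV.indep⟩⟩, rfl, ?_, ?_⟩
    · exact mem_letters_traceOfSets.2 ⟨Q.2, List.mem_map_of_mem hQ, hb⟩
    · rw [List.map_cons, traceOfSets_cons]
    · simp only [rightFactor, List.map_cons, traceOfSets_cons]

/-- The splittings of normal forms whose right factor lies in `K`. -/
def splitLanguage (K : Set D.Trace) : Language (D.IndepSet × D.IndepSet) :=
  {V | IsSplitting V ∧ rightFactor V ∈ K}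

theorem of_zip_mem_splitLanguage {K : Set D.Trace} {W w : List D.IndepSet}
    (hlen : w.length = W.length) (h : W.zip w ∈ splitLanguage K) :
    D.IsExtFoata W ∧ D.IsExtFoata w ∧ ∃ y ∈ K, D.traceOfSets W = D.traceOfSets w * y := by
  obtain ⟨hV, hK⟩ := h
  have hfst : (W.zip w).map Prod.fst = W := List.map_fst_zip hlen.ge
  have hsnd : (W.zip w).map Prod.snd = w := List.map_snd_zip hlen.le
  refine ⟨hfst ▸ hV.isExtFoata, hsnd ▸ isExtFoata_map_snd hV, _, hK, ?_⟩
  simpa only [hfst, hsnd] using traceOfSets_map_fst hV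

theorem exists_zip_mem_splitLanguage {K : Set D.Trace} {W : List D.IndepSet} {x y : D.Trace}
    (hW : D.IsExtFoata W) (h : D.traceOfSets W = x * y) (hy : y ∈ K) :
    ∃ w, w.length = W.length ∧ D.IsExtFoata w ∧ D.traceOfSets w = x ∧
      W.zip w ∈ splitLanguage K := by
  obtain ⟨V, hV, rfl, rfl, rfl⟩ := exists_isSplitting hW h
  refine ⟨V.map Prod.snd, by simp only [List.length_map], isExtFoata_map_snd hV, rfl, ?_⟩
  rw [← List.zip_of_prod rfl rfl]
  exact ⟨hV, hy⟩

theorem foataLanguage_mulProd (R : Set (D.Trace × D.Trace)) (K L : Set D.Trace) :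
    D.foataLanguage (D.mulProd R K L) =
      compConverse (splitLanguage K) (compConverse (splitLanguage L) (D.foataLanguage R)) := by
  ext W
  constructor
  · rintro ⟨hW₁, hW₂, x₁, x₂, y, z, hR, hy, hz, h⟩
    obtain ⟨h₁, h₂⟩ := Prod.ext_iff.1 h
    obtain ⟨v, hv, hvF, rfl, hWv⟩ := exists_zip_mem_splitLanguage hW₁ h₁ hy
    obtain ⟨w, hw, hwF, rfl, hWw⟩ := exists_zip_mem_splitLanguage hW₂ h₂ hz
    rw [List.length_map] at hv hw
    refine ⟨v, hv, hWv, w, by simp [hv, hw], ?_, ?_⟩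
    · rwa [List.map_fst_zip (by simp [hv])]
    · rw [List.map_snd_zip (by simp [hv]), zip_mem_foataLanguage (hw.trans hv.symm)]
      exact ⟨hvF, hwF, hR⟩
  · rintro ⟨v, hv, hWv, w, hw, hWw, hvw⟩
    replace hw : w.length = W.length := by simpa [hv] using hw
    rw [List.map_fst_zip (by simp [hv])] at hWw
    rw [List.map_snd_zip (by simp [hv]), zip_mem_foataLanguage (hw.trans hv.symm)] at hvw
    obtain ⟨hW₁, -, y, hy, h₁⟩ := of_zip_mem_splitLanguage (by simpa using hv) hWv
    obtain ⟨hW₂, -, z, hz, h₂⟩ := of_zip_mem_splitLanguage (by simpa using hw) hWw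
    exact ⟨hW₁, hW₂, _, _, y, z, hvw.2.2, hy, hz, Prod.ext h₁ h₂⟩

end Splitting

end Dependence

/-! ### Automata -/

section Automata

variable {α β γ δ : Type*} {σ τ : Type*}

theorem mem_acceptsFrom_iff_exists {M : NFA α σ} {S : Set σ} {w : List α} :
    w ∈ M.acceptsFrom S ↔ ∃ s ∈ S, w ∈ M.acceptsFrom {s} := by
  simp only [NFA.mem_acceptsFrom]
  constructor
  · rintro ⟨t, ht, htS⟩
    obtain ⟨s, hs, hts⟩ := NFA.mem_evalFrom_iff_exists.1 htS
    exact ⟨s, hs, t, ht, hts⟩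
  · rintro ⟨s, hs, t, ht, hts⟩
    exact ⟨t, ht, NFA.mem_evalFrom_iff_exists.2 ⟨s, hs, hts⟩⟩

theorem nil_mem_acceptsFrom_singleton {M : NFA α σ} {s : σ} :
    [] ∈ M.acceptsFrom {s} ↔ s ∈ M.accept := by
  simp [NFA.mem_acceptsFrom]

theorem append_mem_acceptsFrom_singleton {M : NFA α σ} {s : σ} {v w : List α} :
    v ++ w ∈ M.acceptsFrom {s} ↔ ∃ t ∈ M.evalFrom {s} v, w ∈ M.acceptsFrom {t} := by
  rw [NFA.append_mem_acceptsFrom, mem_acceptsFrom_iff_exists]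

theorem cons_mem_acceptsFrom_singleton {M : NFA α σ} {s : σ} {a : α} {w : List α} :
    a :: w ∈ M.acceptsFrom {s} ↔ ∃ t ∈ M.step s a, w ∈ M.acceptsFrom {t} := by
  rw [NFA.cons_mem_acceptsFrom, NFA.stepSet_singleton, mem_acceptsFrom_iff_exists]

/-- A relation between the states of two automata that transfers accepting runs of the first one
to the second one. -/
structure IsSimulation (M : NFA α σ) (N : NFA α τ) (r : σ → τ → Prop) : Prop where
  start : ∀ s ∈ M.start, ∃ t ∈ N.start, r s t
  step : ∀ s t a, r s t → ∀ s' ∈ M.step s a, ∃ t' ∈ N.step t a, r s' t'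
  accept : ∀ s t, r s t → s ∈ M.accept → t ∈ N.accept

theorem IsSimulation.accepts_subset {M : NFA α σ} {N : NFA α τ} {r : σ → τ → Prop}
    (h : IsSimulation M N r) {w : List α} (hw : w ∈ M.accepts) : w ∈ N.accepts := by
  have hfrom (s t) (hst : r s t) (hs : w ∈ M.acceptsFrom {s}) : w ∈ N.acceptsFrom {t} := by
    clear hw
    induction w generalizing s t with
    | nil =>
      rw [nil_mem_acceptsFrom_singleton] at hs ⊢
      exact h.accept s t hst hs
    | cons a w ih =>
      obtain ⟨s', hs', hw⟩ := cons_mem_acceptsFrom_singleton.1 hs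
      obtain ⟨t', ht', hst'⟩ := h.step s t a hst s' hs'
      exact cons_mem_acceptsFrom_singleton.2 ⟨t', ht', ih s' t' hst' hw⟩
  rw [NFA.accepts_eq_acceptsFrom_start] at hw ⊢
  obtain ⟨s, hs, hsw⟩ := mem_acceptsFrom_iff_exists.1 hw
  obtain ⟨t, ht, hst⟩ := h.start s hs
  exact mem_acceptsFrom_iff_exists.2 ⟨t, ht, hfrom s t hst hsw⟩

theorem accepts_eq_of_isSimulation {M : NFA α σ} {N : NFA α τ} {r : σ → τ → Prop}
    (h : IsSimulation M N r) (h' : IsSimulation N M (flip r)) : M.accepts = N.accepts :=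
  Set.Subset.antisymm (fun _ => h.accepts_subset) fun _ => h'.accepts_subset

/-- The automaton for `compConverse`: it guesses the common second component of the words read by
`M` and by `N`. -/
def compConverseNFA (M : NFA (β × γ) σ) (N : NFA (δ × γ) τ) : NFA (β × δ) (σ × τ) where
  step p a := {q | ∃ c, q.1 ∈ M.step p.1 (a.1, c) ∧ q.2 ∈ N.step p.2 (a.2, c)}
  start := M.start ×ˢ N.start
  accept := M.accept ×ˢ N.accept

theorem mem_acceptsFrom_compConverseNFA {M : NFA (β × γ) σ} {N : NFA (δ × γ) τ} {p : σ × τ}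
    {W : List (β × δ)} : W ∈ (compConverseNFA M N).acceptsFrom {p} ↔
      ∃ w : List γ, w.length = W.length ∧ (W.map Prod.fst).zip w ∈ M.acceptsFrom {p.1} ∧
        (W.map Prod.snd).zip w ∈ N.acceptsFrom {p.2} := by
  induction W generalizing p with
  | nil => simp [compConverseNFA]
  | cons a W ih =>
    rw [cons_mem_acceptsFrom_singleton]
    constructor
    · rintro ⟨q, ⟨c, hM, hN⟩, hq⟩
      obtain ⟨w, hlen, hwM, hwN⟩ := ih.1 hq
      exact ⟨c :: w, congr_arg Nat.succ hlen, cons_mem_acceptsFrom_singleton.2 ⟨q.1, hM, hwM⟩,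
        cons_mem_acceptsFrom_singleton.2 ⟨q.2, hN, hwN⟩⟩
    · rintro ⟨_ | ⟨c, w⟩, hlen, hwM, hwN⟩
      · simp at hlen
      obtain ⟨s, hM, hsM⟩ := cons_mem_acceptsFrom_singleton.1 hwM
      obtain ⟨t, hN, htN⟩ := cons_mem_acceptsFrom_singleton.1 hwN
      exact ⟨(s, t), ⟨c, hM, hN⟩, ih.2 ⟨w, Nat.succ.inj hlen, hsM, htN⟩⟩

theorem accepts_compConverseNFA (M : NFA (β × γ) σ) (N : NFA (δ × γ) τ) :
    (compConverseNFA M N).accepts = compConverse M.accepts N.accepts := by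
  ext W
  simp only [NFA.accepts_eq_acceptsFrom_start, compConverse]
  rw [mem_acceptsFrom_iff_exists]
  simp only [mem_acceptsFrom_compConverseNFA]
  change _ ↔ ∃ w, _ ∧ _ ∈ M.acceptsFrom _ ∧ _ ∈ N.acceptsFrom _
  constructor
  · rintro ⟨p, hp, w, hlen, hwM, hwN⟩
    exact ⟨w, hlen, mem_acceptsFrom_iff_exists.2 ⟨_, hp.1, hwM⟩,
      mem_acceptsFrom_iff_exists.2 ⟨_, hp.2, hwN⟩⟩
  · rintro ⟨w, hlen, hwM, hwN⟩
    obtain ⟨s, hs, hsM⟩ := mem_acceptsFrom_iff_exists.1 hwM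
    obtain ⟨t, ht, htN⟩ := mem_acceptsFrom_iff_exists.1 hwN
    exact ⟨(s, t), ⟨hs, ht⟩, w, hlen, hsM, htN⟩

theorem isRegular_accepts [Finite σ] (M : NFA α σ) : M.accepts.IsRegular := by
  have := Fintype.ofFinite σ
  classical
  exact Language.isRegular_iff.2 ⟨Set σ, inferInstance, M.toDFA, NFA.toDFA_correct⟩

theorem isRegular_compConverse {L : Language (β × γ)} {L' : Language (δ × γ)} (hL : L.IsRegular)
    (hL' : L'.IsRegular) : (compConverse L L').IsRegular := by
  obtain ⟨σ, _, M, rfl⟩ := hL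
  obtain ⟨τ, _, N, rfl⟩ := hL'
  rw [← M.toNFA_correct, ← N.toNFA_correct, ← accepts_compConverseNFA]
  exact isRegular_accepts _

end Automata

namespace Dependence

variable {α : Type u} {D : Dependence α}

/-- The states of the automaton for `splitLanguage`: the layer read last, the letters left out of
the left factor so far, and the state reached by the automaton that reads the right factor. -/
structure SplitState (α : Type*) (σ : Type*) where
  last : Finset α
  delayed : Finset α
  state : σ

theorem finite_splitState [Finite α] {σ : Type*} [Finite σ] : Finite (SplitState α σ) :=
  .of_injective (fun p => (p.last, p.delayed, p.state)) fun ⟨_, _, _⟩ ⟨_, _, _⟩ h => by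
    cases h; rfl

/-- A word inducing the right factor encoded by a splitting. -/
def rightWord [LinearOrder α] (V : List (D.IndepSet × D.IndepSet)) : List α :=
  V.flatMap fun P => (P.1.1 \ P.2.1).sort

theorem traceOfWord_rightWord [LinearOrder α] (V : List (D.IndepSet × D.IndepSet)) :
    D.traceOfWord (rightWord V) = rightFactor V := by
  induction V with
  | nil => rfl
  | cons P V ih =>
    rw [rightFactor, List.map_cons, traceOfSets_cons, traceOfSet_eq_traceOfWord_sort]
    exact congr_arg (D.traceOfWord (P.1.1 \ P.2.1).sort * ·) ih

section SplitNFA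

variable [Fintype α] [LinearOrder α] {σ : Type*} {M : NFA α σ}

/-- The automaton for `splitLanguage K`, where `M` is an automaton for the word language of `K`. -/
def splitNFA (M : NFA α σ) : NFA (D.IndepSet × D.IndepSet) (SplitState α σ) where
  step p P := {q | P.2.1 ⊆ P.1.1 ∧ (∀ b ∈ P.1.1, ∃ a ∈ p.last, D.Dep a b) ∧
    (∀ a ∈ p.delayed, ∀ b ∈ P.2.1, D.Indep a b) ∧ q.last = P.1.1 ∧
    q.delayed = p.delayed ∪ P.1.1 \ P.2.1 ∧
    q.state ∈ M.evalFrom {p.state} (P.1.1 \ P.2.1).sort}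
  start := {p | p.last = Finset.univ ∧ p.delayed = ∅ ∧ p.state ∈ M.start}
  accept := {p | p.state ∈ M.accept}

theorem mem_acceptsFrom_splitNFA {p : SplitState α σ} {V : List (D.IndepSet × D.IndepSet)} :
    V ∈ (splitNFA M).acceptsFrom {p} ↔
      ((p.last :: V.map (·.1.1)).IsChain fun A B => ∀ b ∈ B, ∃ a ∈ A, D.Dep a b) ∧
      (∀ P ∈ V, P.2.1 ⊆ P.1.1) ∧
      (V.Pairwise fun P Q => ∀ a ∈ P.1.1 \ P.2.1, ∀ b ∈ Q.2.1, D.Indep a b) ∧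
      (∀ Q ∈ V, ∀ a ∈ p.delayed, ∀ b ∈ Q.2.1, D.Indep a b) ∧
      rightWord V ∈ M.acceptsFrom {p.state} := by
  induction V generalizing p with
  | nil => simp [splitNFA, rightWord]
  | cons P V ih =>
    have hright : rightWord (P :: V) ∈ M.acceptsFrom {p.state} ↔
        ∃ t ∈ M.evalFrom {p.state} (P.1.1 \ P.2.1).sort, rightWord V ∈ M.acceptsFrom {t} := by
      rw [rightWord, List.flatMap_cons, append_mem_acceptsFrom_singleton, rightWord]
    simp only [cons_mem_acceptsFrom_singleton, hright, List.map_cons, List.isChain_cons_cons,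
      List.forall_mem_cons, List.pairwise_cons]
    constructor
    · rintro ⟨q, ⟨hsub, hdep, hind, hlast, hdelayed, hstate⟩, hq⟩
      obtain ⟨hchain, hsubs, hpair, hinds, hw⟩ := ih.1 hq
      rw [hdelayed] at hinds
      exact ⟨⟨hdep, hlast ▸ hchain⟩, ⟨hsub, hsubs⟩,
        ⟨fun Q hQ a ha => hinds Q hQ a (Finset.mem_union_right _ ha), hpair⟩,
        ⟨hind, fun Q hQ a ha => hinds Q hQ a (Finset.mem_union_left _ ha)⟩, q.state, hstate, hw⟩
    · rintro ⟨⟨hdep, hchain⟩, ⟨hsub, hsubs⟩, ⟨hpairP, hpair⟩, ⟨hind, hinds⟩, t, ht, hw⟩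
      refine ⟨⟨P.1.1, p.delayed ∪ P.1.1 \ P.2.1, t⟩, ⟨hsub, hdep, hind, rfl, rfl, ht⟩,
        ih.2 ⟨hchain, hsubs, hpair, fun Q hQ a ha => ?_, hw⟩⟩
      exact (Finset.mem_union.1 ha).elim (hinds Q hQ a) (hpairP Q hQ a)

theorem accepts_splitNFA {K : Set D.Trace} (hM : M.accepts = D.wordLanguage K) :
    (splitNFA M).accepts = splitLanguage K := by
  ext V
  have hright : rightWord V ∈ M.accepts ↔ rightFactor V ∈ K := by
    rw [hM, ← traceOfWord_rightWord]
    rfl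
  have hchain : ((Finset.univ :: V.map (·.1.1)).IsChain
      fun A B => ∀ b ∈ B, ∃ a ∈ A, D.Dep a b) ↔ D.IsExtFoata (V.map Prod.fst) := by
    cases V with
    | nil => simp [IsExtFoata]
    | cons P V =>
      rw [List.map_cons, List.isChain_cons_cons,
        and_iff_right fun b _ => ⟨b, Finset.mem_univ b, D.refl b⟩, IsExtFoata, List.isChain_map]
      exact List.isChain_map (fun P : D.IndepSet × D.IndepSet => P.1.1) (l := P :: V)
  rw [NFA.accepts_eq_acceptsFrom_start, mem_acceptsFrom_iff_exists] at *
  simp only [mem_acceptsFrom_splitNFA]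
  constructor
  · rintro ⟨p, ⟨hlast, -, hstart⟩, hc, hsub, hpair, -, hw⟩
    exact ⟨⟨hchain.1 (hlast ▸ hc), hsub, hpair⟩, hright.1 ⟨p.state, hstart, hw⟩⟩
  · rintro ⟨hV, hK⟩
    obtain ⟨s, hs, hw⟩ := hright.2 hK
    exact ⟨⟨Finset.univ, ∅, s⟩, ⟨rfl, rfl, hs⟩, hchain.2 hV.isExtFoata, hV.subset, hV.indep,
      by simp, hw⟩

end SplitNFA

theorem isRegular_splitLanguage [Finite α] [LinearOrder α] {K : Set D.Trace}
    (hK : D.IsRecognizable K) : (splitLanguage K).IsRegular := by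
  cases nonempty_fintype α
  obtain ⟨σ, _, M, hM⟩ := hK
  have := finite_splitState (α := α) (σ := σ)
  rw [← accepts_splitNFA (M.toNFA_correct.trans hM)]
  exact isRegular_accepts _

theorem isFnfAutomatic_mulProd [Finite α] {R : Set (D.Trace × D.Trace)} {K L : Set D.Trace}
    (hR : D.IsFnfAutomatic R) (hK : D.IsRecognizable K) (hL : D.IsRecognizable L) :
    D.IsFnfAutomatic (D.mulProd R K L) := by
  have := Fintype.ofFinite α
  let _ : LinearOrder α := .lift' _ (Fintype.equivFin α).injective
  rw [IsFnfAutomatic, foataLanguage_mulProd]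
  exact isRegular_compConverse (isRegular_splitLanguage hK)
    (isRegular_compConverse (isRegular_splitLanguage hL) hR)

end Dependence

/-! ### Codes of automata -/

namespace NFACode

/-- The initial states of a code and the targets of its transitions. -/
def states {β : Type} (c : NFACode β) : List ℕ := c.1 ++ c.2.1.map (·.2.2)

/-- The states reached from those in the list `Q` by transitions labelled `a`. -/
def stepList (c : NFACode ℕ) (Q : List ℕ) (a : ℕ) : List ℕ :=
  (c.2.1.filter fun t => t.1 ∈ Q ∧ t.2.1 = a).map (·.2.2)

/-- The states reached from those in the list `Q` by reading `w`. -/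
def evalList (c : NFACode ℕ) (Q w : List ℕ) : List ℕ := w.foldl c.stepList Q

theorem mem_evalList {n : ℕ} {c : NFACode ℕ} {w : List (Fin n)} {Q : List ℕ} {s : ℕ} :
    s ∈ c.evalList Q (w.map Fin.val) ↔ s ∈ (c.toNFA DescribesLetter).evalFrom {q | q ∈ Q} w := by
  induction w generalizing Q with
  | nil => rfl
  | cons a w ih =>
    have hstep : {q | q ∈ c.stepList Q a} =
        (c.toNFA DescribesLetter).stepSet {q | q ∈ Q} a := by
      ext q
      simp only [stepList, toNFA, DescribesLetter, NFA.mem_stepSet, Set.mem_ofPred_eq,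
        List.mem_map, List.mem_filter, decide_eq_true_eq, Prod.exists]
      grind
    rw [NFA.evalFrom_cons, ← hstep, ← ih]
    rfl

variable {α : Type u} {β : Type} {r : β → α → Prop} {c : NFACode β}

theorem mem_states_of_mem_step {s t : ℕ} {a : α} (h : t ∈ (c.toNFA r).step s a) :
    t ∈ c.states := by
  obtain ⟨b, -, h⟩ := h
  exact List.mem_append_right _ (List.mem_map_of_mem h)

theorem mem_states_of_mem_evalFrom {w : List α} {S : Set ℕ} {t : ℕ} (hS : ∀ s ∈ S, s ∈ c.states)
    (h : t ∈ (c.toNFA r).evalFrom S w) : t ∈ c.states := by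
  induction w generalizing S with
  | nil => exact hS t h
  | cons a w ih =>
    rw [NFA.evalFrom_cons] at h
    refine ih (fun s hs => ?_) h
    obtain ⟨_, -, hs⟩ := NFA.mem_stepSet.1 hs
    exact mem_states_of_mem_step hs

end NFACode

section LetterList

variable {n : ℕ} {A B : Finset (Fin n)}

/-- The elements of a set of letters in increasing order, as natural numbers. -/
def letterList (A : Finset (Fin n)) : List ℕ := A.sort.map Fin.val

theorem mem_letterList {x : ℕ} : x ∈ letterList A ↔ ∃ a ∈ A, (a : ℕ) = x := by
  simp [letterList]

theorem forall_mem_letterList {P : ℕ → Prop} : (∀ x ∈ letterList A, P x) ↔ ∀ a ∈ A, P a := by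
  simp [letterList]

theorem val_mem_letterList {a : Fin n} : (a : ℕ) ∈ letterList A ↔ a ∈ A := by
  simp [letterList, Fin.val_inj]

theorem toFinset_letterList : (letterList A).toFinset = A.map Fin.valEmbedding := by
  ext x
  simp [mem_letterList]

theorem letterList_injective : Function.Injective (letterList (n := n)) := fun A B h => by
  ext a
  rw [← val_mem_letterList, h, val_mem_letterList]

theorem pairwise_letterList : (letterList A).Pairwise (· < ·) :=
  List.pairwise_map.2 A.sortedLT_sort.pairwise

theorem eq_letterList_iff {l : List ℕ} :
    l = letterList A ↔ l.Pairwise (· < ·) ∧ ∀ x, x ∈ l ↔ ∃ a ∈ A, (a : ℕ) = x := by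
  constructor
  · rintro rfl
    exact ⟨pairwise_letterList, fun _ => mem_letterList⟩
  · rintro ⟨hl, h⟩
    exact hl.eq_of_mem_iff pairwise_letterList fun x => (h x).trans mem_letterList.symm

theorem letterList_empty : letterList (∅ : Finset (Fin n)) = [] := by
  simp [letterList]

theorem letterList_univ : letterList (Finset.univ : Finset (Fin n)) = List.range n := by
  rw [letterList, Fin.sort_univ, List.map_coe_finRange_eq_range]

theorem letterList_sdiff :
    letterList (A \ B) = (letterList A).filter (· ∉ letterList B) := by
  refine (eq_letterList_iff.2 ⟨pairwise_letterList.filter _, fun x => ?_⟩).symm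
  simp only [List.mem_filter, decide_eq_true_eq, Finset.mem_sdiff, mem_letterList]
  grind

theorem letterList_union_sdiff {C : Finset (Fin n)} :
    letterList (C ∪ A \ B) = (List.range n).filter fun x =>
      x ∈ letterList C ∨ x ∈ letterList A ∧ x ∉ letterList B := by
  refine (eq_letterList_iff.2 ⟨List.pairwise_lt_range.filter _, fun x => ?_⟩).symm
  simp only [List.mem_filter, decide_eq_true_eq, Finset.mem_union, Finset.mem_sdiff,
    mem_letterList, List.mem_range]
  grind

theorem mem_sublists_range {l : List ℕ} :
    l ∈ (List.range n).sublists' ↔ ∃ A : Finset (Fin n), letterList A = l := by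
  rw [List.mem_sublists']
  constructor
  · intro h
    refine ⟨Finset.univ.filter fun a => (a : ℕ) ∈ l,
      (eq_letterList_iff.2 ⟨List.pairwise_lt_range.sublist h, fun x => ?_⟩).symm⟩
    have hx (hx : x ∈ l) : x < n := List.mem_range.1 (h.subset hx)
    simp only [Finset.mem_filter_univ]
    exact ⟨fun h => ⟨⟨x, hx h⟩, h, rfl⟩, by rintro ⟨a, ha, rfl⟩; exact ha⟩
  · rintro ⟨A, rfl⟩
    rw [← letterList_univ, ← Finset.sdiff_sdiff_eq_self A.subset_univ, letterList_sdiff]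
    exact List.filter_sublist

theorem describesSets_letterList {D : Dependence (Fin n)} {P Q : D.IndepSet × D.IndepSet} :
    DescribesSets D (letterList P.1.1, letterList P.2.1) Q ↔ P = Q := by
  rw [DescribesSets, toFinset_letterList, toFinset_letterList, Finset.map_inj, Finset.map_inj,
    Prod.ext_iff]
  exact and_congr Subtype.ext_iff.symm Subtype.ext_iff.symm

end LetterList

/-! ### Computing the automata -/

namespace NFACode

/-- The code of `compConverseNFA` for automata over pairs of independent sets. -/
def compConverse (c c' : NFACode (List ℕ × List ℕ)) : NFACode (List ℕ × List ℕ) :=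
  ((c.1.product c'.1).map fun p => Nat.pair p.1 p.2,
    ((c.2.1.product c'.2.1).filter fun t => t.1.2.1.2.toFinset = t.2.2.1.2.toFinset).map fun t =>
      (Nat.pair t.1.1 t.2.1, (t.1.2.1.1, t.2.2.1.1), Nat.pair t.1.2.2 t.2.2.2),
    (c.2.2.product c'.2.2).map fun p => Nat.pair p.1 p.2)

theorem mem_transitions_compConverse {c c' : NFACode (List ℕ × List ℕ)} {k k' : ℕ}
    {b : List ℕ × List ℕ} : (k, b, k') ∈ (c.compConverse c').2.1 ↔
      ∃ p l q p' l' q', (p, (b.1, l), q) ∈ c.2.1 ∧ (p', (b.2, l'), q') ∈ c'.2.1 ∧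
        l.toFinset = l'.toFinset ∧ k = Nat.pair p p' ∧ k' = Nat.pair q q' := by
  simp only [compConverse, List.mem_map, List.mem_filter, decide_eq_true_eq, Prod.exists,
    List.pair_mem_product, Prod.ext_iff]
  grind

section CompConverse

variable {n : ℕ} {D : Dependence (Fin n)} {c c' : NFACode (List ℕ × List ℕ)}

theorem isSimulation_compConverse (hc : ∀ t ∈ c.2.1, ∃ P, DescribesSets D t.2.1 P) :
    IsSimulation ((c.compConverse c').toNFA (DescribesSets D))
      (compConverseNFA (c.toNFA (DescribesSets D)) (c'.toNFA (DescribesSets D)))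
      (fun k p => k = Nat.pair p.1 p.2) where
  start k hk := by
    obtain ⟨p, hp, rfl⟩ := List.mem_map.1 hk
    exact ⟨p, List.pair_mem_product.1 hp, rfl⟩
  step := by
    rintro _ ⟨s, s'⟩ A rfl k' ⟨b, hb, ht⟩
    obtain ⟨p, l, q, p', l', q', ht, ht', hl, hk, rfl⟩ := mem_transitions_compConverse.1 ht
    obtain ⟨rfl, rfl⟩ := Nat.pair_eq_pair.1 hk
    obtain ⟨P, hP⟩ := hc _ ht
    exact ⟨(q, q'), ⟨P.2, ⟨(b.1, l), ⟨hb.1, hP.2⟩, ht⟩,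
      ⟨(b.2, l'), ⟨hb.2, hl.symm.trans hP.2⟩, ht'⟩⟩, rfl⟩
  accept := by
    rintro _ p rfl hk
    obtain ⟨p', hp', h⟩ := List.mem_map.1 hk
    obtain ⟨h₁, h₂⟩ := Nat.pair_eq_pair.1 h
    obtain rfl : p' = p := Prod.ext h₁ h₂
    exact List.pair_mem_product.1 hp'

theorem isSimulation_compConverseNFA :
    IsSimulation (compConverseNFA (c.toNFA (DescribesSets D)) (c'.toNFA (DescribesSets D)))
      ((c.compConverse c').toNFA (DescribesSets D)) (fun p k => k = Nat.pair p.1 p.2) where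
  start p hp := ⟨_, List.mem_map.2 ⟨p, List.pair_mem_product.2 hp, rfl⟩, rfl⟩
  step := by
    rintro ⟨s, s'⟩ _ A rfl ⟨t, t'⟩ ⟨C, ⟨b, hb, ht⟩, ⟨b', hb', ht'⟩⟩
    exact ⟨_, ⟨(b.1, b'.1), ⟨hb.1, hb'.1⟩, mem_transitions_compConverse.2
      ⟨_, _, _, _, _, _, ht, ht', hb.2.trans hb'.2.symm, rfl, rfl⟩⟩, rfl⟩
  accept := by
    rintro p _ rfl hp
    exact List.mem_map.2 ⟨p, List.pair_mem_product.2 hp, rfl⟩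

theorem presents_compConverse {L L' : Language (D.IndepSet × D.IndepSet)}
    (hc : c.Presents (DescribesSets D) L) (hc' : c'.Presents (DescribesSets D) L') :
    (c.compConverse c').Presents (DescribesSets D) (FoataTrace.compConverse L L') := by
  constructor
  · rintro ⟨k, b, k'⟩ ht
    obtain ⟨p, l, q, p', l', q', ht, ht', -⟩ := mem_transitions_compConverse.1 ht
    obtain ⟨P, hP⟩ := hc.1 _ ht
    obtain ⟨P', hP'⟩ := hc'.1 _ ht'
    exact ⟨(P.1, P'.1), hP.1, hP'.1⟩
  · rw [← hc.2, ← hc'.2, ← accepts_compConverseNFA]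
    exact accepts_eq_of_isSimulation (isSimulation_compConverse hc.1) isSimulation_compConverseNFA

end CompConverse

end NFACode

/-- The condition under which the automaton `splitNFA` can read the sets listed by `A` and `B`, in
a state with the sets listed by `last` and `delayed`; the list `d` describes the dependence
relation. -/
def CanSplit (d : List (ℕ × ℕ)) (last delayed A B : List ℕ) : Prop :=
  (∀ a ∈ A, ∀ b ∈ A, a = b ∨ (a, b) ∉ d) ∧ (∀ b ∈ B, b ∈ A) ∧
    (∀ b ∈ A, ∃ a ∈ last, (a, b) ∈ d) ∧ ∀ a ∈ delayed, ∀ b ∈ B, (a, b) ∉ d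

instance (d : List (ℕ × ℕ)) (last delayed A B : List ℕ) :
    Decidable (CanSplit d last delayed A B) := by
  unfold CanSplit
  infer_instance

/-- The triples that encode a `SplitState` over the letters `0, …, n - 1`, with its last component
in the list `Q`. -/
def splitStates (n : ℕ) (Q : List ℕ) : List (List ℕ × List ℕ × ℕ) :=
  (List.range n).sublists'.product ((List.range n).sublists'.product Q)

/-- The code of `splitNFA` for the dependence relation described by `d`, where `c` is the code of
an automaton for a word language over the letters `0, …, n - 1`. -/
def splitCode (n : ℕ) (d : List (ℕ × ℕ)) (c : NFACode ℕ) : NFACode (List ℕ × List ℕ) :=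
  (c.1.map fun s => Encodable.encode (List.range n, ([] : List ℕ), s),
    (((splitStates n c.states).product
      ((List.range n).sublists'.product (List.range n).sublists')).filter fun t =>
        CanSplit d t.1.1 t.1.2.1 t.2.1 t.2.2).flatMap fun t =>
      (c.evalList [t.1.2.2] (t.2.1.filter (· ∉ t.2.2))).map fun s =>
        (Encodable.encode t.1, t.2, Encodable.encode (t.2.1,
          (List.range n).filter (fun x => x ∈ t.1.2.1 ∨ x ∈ t.2.1 ∧ x ∉ t.2.2), s)),
    (splitStates n c.2.2).map Encodable.encode)

section SplitCode

variable {n : ℕ} {D : Dependence (Fin n)} {d : List (ℕ × ℕ)} {c : NFACode ℕ}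

/-- The number that encodes a state of `splitNFA` in `splitCode`. -/
def encodeSplitState (p : Dependence.SplitState (Fin n) ℕ) : ℕ :=
  Encodable.encode (letterList p.last, letterList p.delayed, p.state)

theorem encodeSplitState_injective : Function.Injective (encodeSplitState (n := n)) := by
  rintro ⟨A, B, s⟩ ⟨A', B', s'⟩ h
  simpa [encodeSplitState, letterList_injective.eq_iff] using h

theorem mem_splitStates {Q : List ℕ} {x : List ℕ × List ℕ × ℕ} :
    x ∈ splitStates n Q ↔ ∃ p : Dependence.SplitState (Fin n) ℕ, p.state ∈ Q ∧
      (letterList p.last, letterList p.delayed, p.state) = x := by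
  obtain ⟨l, l', s⟩ := x
  simp only [splitStates, List.pair_mem_product, mem_sublists_range]
  constructor
  · rintro ⟨⟨A, rfl⟩, ⟨B, rfl⟩, hs⟩
    exact ⟨⟨A, B, s⟩, hs, rfl⟩
  · rintro ⟨⟨A, B, s⟩, hs, ⟨⟩⟩
    exact ⟨⟨A, rfl⟩, ⟨B, rfl⟩, hs⟩

theorem canSplit_letterList (hd : DescribesDependence d D) {last delayed A B : Finset (Fin n)} :
    CanSplit d (letterList last) (letterList delayed) (letterList A) (letterList B) ↔
      (A : Set (Fin n)).Pairwise D.Indep ∧ B ⊆ A ∧ (∀ b ∈ A, ∃ a ∈ last, D.Dep a b) ∧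
        ∀ a ∈ delayed, ∀ b ∈ B, D.Indep a b := by
  have hdep (b : Fin n) : (∃ x ∈ letterList last, (x, (b : ℕ)) ∈ d) ↔
      ∃ a ∈ last, D.Dep a b := by
    simp [mem_letterList, hd _ _]
  simp only [CanSplit, forall_mem_letterList, val_mem_letterList, hdep,
    Dependence.indep_iff_not_dep, hd _ _, Fin.val_inj, Set.Pairwise, Finset.mem_coe,
    Finset.subset_iff]
  grind

theorem mem_evalList_filter {A B : Finset (Fin n)} {s t : ℕ} :
    t ∈ c.evalList [s] ((letterList A).filter (· ∉ letterList B)) ↔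
      t ∈ (c.toNFA DescribesLetter).evalFrom {s} (A \ B).sort := by
  rw [← letterList_sdiff, letterList, NFACode.mem_evalList]
  simp only [List.mem_singleton]
  rfl

theorem mem_transitions_splitCode (hd : DescribesDependence d D) {k k' : ℕ}
    {b : List ℕ × List ℕ} : (k, b, k') ∈ (splitCode n d c).2.1 ↔
      ∃ (p : Dependence.SplitState (Fin n) ℕ) (P : D.IndepSet × D.IndepSet),
        ∃ q ∈ (Dependence.splitNFA (c.toNFA DescribesLetter)).step p P, p.state ∈ c.states ∧
          k = encodeSplitState p ∧ b = (letterList P.1.1, letterList P.2.1) ∧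
          k' = encodeSplitState q := by
  simp only [splitCode, List.mem_flatMap, List.mem_map, List.mem_filter, decide_eq_true_eq]
  constructor
  · rintro ⟨⟨x, l, l'⟩, ⟨hx, hsplit⟩, s, hs, ⟨⟩⟩
    obtain ⟨hx, hl⟩ := List.pair_mem_product.1 hx
    obtain ⟨p, hp, rfl⟩ := mem_splitStates.1 hx
    obtain ⟨hA, hB⟩ := List.pair_mem_product.1 hl
    obtain ⟨A, rfl⟩ := mem_sublists_range.1 hA
    obtain ⟨B, rfl⟩ := mem_sublists_range.1 hB
    obtain ⟨hA, hBA, hdep, hind⟩ := (canSplit_letterList hd).1 hsplit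
    refine ⟨p, (⟨A, hA⟩, ⟨B, hA.mono (Finset.coe_subset.2 hBA)⟩), ⟨A, p.delayed ∪ A \ B, s⟩,
      ⟨hBA, hdep, hind, rfl, rfl, mem_evalList_filter.1 hs⟩, hp, rfl, rfl, ?_⟩
    rw [encodeSplitState, letterList_union_sdiff]
  · rintro ⟨p, P, ⟨_, _, s⟩, ⟨hBA, hdep, hind, rfl, rfl, hs⟩, hp, rfl, rfl, rfl⟩
    refine ⟨(_, letterList P.1.1, letterList P.2.1), ⟨List.pair_mem_product.2
      ⟨mem_splitStates.2 ⟨p, hp, rfl⟩, List.pair_mem_product.2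
        ⟨mem_sublists_range.2 ⟨P.1.1, rfl⟩, mem_sublists_range.2 ⟨P.2.1, rfl⟩⟩⟩,
      (canSplit_letterList hd).2 ⟨P.1.2, hBA, hdep, hind⟩⟩, s, mem_evalList_filter.2 hs, ?_⟩
    simp only [encodeSplitState, letterList_union_sdiff]

theorem isSimulation_splitCode (hd : DescribesDependence d D) :
    IsSimulation ((splitCode n d c).toNFA (DescribesSets D))
      (Dependence.splitNFA (c.toNFA DescribesLetter))
      (fun k p => k = encodeSplitState p ∧ p.state ∈ c.states) where
  start k hk := by
    obtain ⟨s, hs, rfl⟩ := List.mem_map.1 hk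
    refine ⟨⟨Finset.univ, ∅, s⟩, ⟨rfl, rfl, hs⟩, ?_, List.mem_append_left _ hs⟩
    rw [encodeSplitState, letterList_univ, letterList_empty]
  step := by
    rintro _ p P ⟨rfl, hp⟩ k' ⟨b, hb, ht⟩
    obtain ⟨p', P', q, hq, -, hpp', rfl, rfl⟩ := (mem_transitions_splitCode hd).1 ht
    obtain rfl := encodeSplitState_injective hpp'
    obtain rfl := describesSets_letterList.1 hb
    exact ⟨q, hq, rfl, NFACode.mem_states_of_mem_evalFrom (by simpa using hp) hq.2.2.2.2.2⟩
  accept := by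
    rintro _ p ⟨rfl, -⟩ hk
    obtain ⟨x, hx, hxp⟩ := List.mem_map.1 hk
    obtain ⟨p', hp', rfl⟩ := mem_splitStates.1 hx
    obtain rfl := encodeSplitState_injective hxp
    exact hp'

theorem isSimulation_splitNFA (hd : DescribesDependence d D) :
    IsSimulation (Dependence.splitNFA (c.toNFA DescribesLetter))
      ((splitCode n d c).toNFA (DescribesSets D))
      (fun p k => k = encodeSplitState p ∧ p.state ∈ c.states) where
  start := by
    rintro ⟨_, _, s⟩ ⟨rfl, rfl, hs⟩
    refine ⟨_, List.mem_map_of_mem hs, ?_, List.mem_append_left _ hs⟩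
    rw [encodeSplitState, letterList_univ, letterList_empty]
  step := by
    rintro p _ P ⟨rfl, hp⟩ q hq
    exact ⟨_, ⟨_, describesSets_letterList.2 rfl,
      (mem_transitions_splitCode hd).2 ⟨p, P, q, hq, hp, rfl, rfl, rfl⟩⟩, rfl,
      NFACode.mem_states_of_mem_evalFrom (by simpa using hp) hq.2.2.2.2.2⟩
  accept := by
    rintro p _ ⟨rfl, -⟩ hp
    exact List.mem_map_of_mem (mem_splitStates.2 ⟨p, hp, rfl⟩)

theorem presents_splitCode (hd : DescribesDependence d D) {K : Set D.Trace}
    (hc : c.Presents DescribesLetter (D.wordLanguage K)) :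
    (splitCode n d c).Presents (DescribesSets D) (Dependence.splitLanguage K) := by
  constructor
  · rintro ⟨k, b, k'⟩ ht
    obtain ⟨p, P, q, -, -, -, rfl, -⟩ := (mem_transitions_splitCode hd).1 ht
    exact ⟨P, describesSets_letterList.2 rfl⟩
  · rw [← Dependence.accepts_splitNFA hc.2]
    exact accepts_eq_of_isSimulation (isSimulation_splitCode hd) (isSimulation_splitNFA hd)

end SplitCode

/-- The algorithm: from the number of letters, the dependence relation and the codes of automata
for `L_R` and for the word languages of `K` and `L`, it computes the code of an automaton for
`L_{R · (K × L)}`. -/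
def mulProdCode (x : (ℕ × List (ℕ × ℕ)) × NFACode (List ℕ × List ℕ) × NFACode ℕ × NFACode ℕ) :
    NFACode (List ℕ × List ℕ) :=
  (splitCode x.1.1 x.1.2 x.2.2.1).compConverse
    ((splitCode x.1.1 x.1.2 x.2.2.2).compConverse x.2.1)

theorem presents_mulProdCode {n : ℕ} {D : Dependence (Fin n)} {d : List (ℕ × ℕ)}
    (hd : DescribesDependence d D) {R : Set (D.Trace × D.Trace)} {K L : Set D.Trace}
    {cR : NFACode (List ℕ × List ℕ)} {cK cL : NFACode ℕ}
    (hR : cR.Presents (DescribesSets D) (D.foataLanguage R))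
    (hK : cK.Presents DescribesLetter (D.wordLanguage K))
    (hL : cL.Presents DescribesLetter (D.wordLanguage L)) :
    (mulProdCode ((n, d), cR, cK, cL)).Presents (DescribesSets D)
      (D.foataLanguage (D.mulProd R K L)) := by
  rw [Dependence.foataLanguage_mulProd]
  exact NFACode.presents_compConverse (presents_splitCode hd hK)
    (NFACode.presents_compConverse (presents_splitCode hd hL) hR)

/-! ### Primitive recursiveness -/

section Primrec

attribute [local fun_prop] Primrec
attribute [local fun_prop] Primrec.id Primrec.const Primrec.comp Primrec.fst Primrec.snd
attribute [local fun_prop] Primrec.pair Primrec.list_range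

variable {ι β γ : Type} [Primcodable ι] [Primcodable β] [Primcodable γ]

theorem primrec_map {f : ι → List β} {g : ι → β → γ} (hf : Primrec f)
    (hg : Primrec fun x : ι × β => g x.1 x.2) : Primrec fun i => (f i).map (g i) :=
  Primrec.list_map hf hg

theorem primrec_filter {f : ι → List β} {p : ι → β → Prop} [∀ i, DecidablePred (p i)]
    (hf : Primrec f) (hp : PrimrecPred fun x : ι × β => p x.1 x.2) :
    Primrec fun i => (f i).filter (p i ·) :=
  (hp.primrecRel.swap.listFilter).comp hf Primrec.id

theorem primrecPred_forall_mem {f : ι → List β} {p : ι → β → Prop} (hf : Primrec f)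
    (hp : PrimrecPred fun x : ι × β => p x.1 x.2) : PrimrecPred fun i => ∀ b ∈ f i, p i b :=
  (hp.primrecRel.swap.forall_mem_list).comp hf Primrec.id

theorem primrecPred_exists_mem {f : ι → List β} {p : ι → β → Prop} (hf : Primrec f)
    (hp : PrimrecPred fun x : ι × β => p x.1 x.2) : PrimrecPred fun i => ∃ b ∈ f i, p i b :=
  (hp.primrecRel.swap.exists_mem_list).comp hf Primrec.id

theorem primrecPred_mem {f : ι → List β} {g : ι → β} (hf : Primrec f) (hg : Primrec g) :
    PrimrecPred fun i => g i ∈ f i :=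
  (primrecPred_exists_mem (p := fun i b => b = g i) hf
    (Primrec.eq.comp (by fun_prop) (by fun_prop))).of_eq fun i => by simp

theorem primrecPred_toFinset_eq [DecidableEq β] {f g : ι → List β} (hf : Primrec f)
    (hg : Primrec g) : PrimrecPred fun i => (f i).toFinset = (g i).toFinset :=
  ((primrecPred_forall_mem (p := fun i b => b ∈ g i) hf (primrecPred_mem (hg.comp .fst) .snd)).and
    (primrecPred_forall_mem (p := fun i b => b ∈ f i) hg
      (primrecPred_mem (hf.comp .fst) .snd))).of_eq fun i => by
    simp only [List.toFinset.ext_iff, iff_def, forall_and]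

theorem primrec_product {f : ι → List β} {g : ι → List γ} (hf : Primrec f) (hg : Primrec g) :
    Primrec fun i => (f i).product (g i) :=
  Primrec.list_flatMap hf
    (primrec_map (g := fun (x : ι × β) c => (x.2, c)) (by fun_prop) (by fun_prop))

theorem primrec_sublists' : Primrec fun l : List β => l.sublists' := by
  refine (Primrec.list_foldr (h := fun _ x => x.2 ++ x.2.map (x.1 :: ·)) Primrec.id
    (Primrec.const [[]]) (Primrec.list_append.comp (by fun_prop) ?_)).of_eq fun l => ?_
  · exact primrec_map (g := fun (x : List β × β × List (List β)) l => x.2.1 :: l) (by fun_prop)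
      (Primrec.list_cons.comp (by fun_prop) (by fun_prop))
  · induction l with
    | nil => rfl
    | cons a l ih => rw [List.sublists'_cons, ← ih]; rfl

theorem primrec_states {c : ι → NFACode β} (hc : Primrec c) : Primrec fun i => (c i).states :=
  Primrec.list_append.comp (by fun_prop)
    (primrec_map (g := fun _ (t : ℕ × β × ℕ) => t.2.2) (by fun_prop) (by fun_prop))

theorem primrec_evalList {c : ι → NFACode ℕ} {Q w : ι → List ℕ} (hc : Primrec c) (hQ : Primrec Q)
    (hw : Primrec w) : Primrec fun i => (c i).evalList (Q i) (w i) := by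
  refine Primrec.list_foldl (h := fun i x => (c i).stepList x.1 x.2) hw hQ ?_
  refine primrec_map (g := fun _ (t : ℕ × ℕ × ℕ) => t.2.2)
    (primrec_filter (p := fun (x : ι × List ℕ × ℕ) (t : ℕ × ℕ × ℕ) => t.1 ∈ x.2.1 ∧ t.2.1 = x.2.2)
      (by fun_prop) ?_) (by fun_prop)
  exact (primrecPred_mem (by fun_prop) (by fun_prop)).and
    (Primrec.eq.comp (by fun_prop) (by fun_prop))

theorem primrec_compConverse {c c' : ι → NFACode (List ℕ × List ℕ)} (hc : Primrec c)
    (hc' : Primrec c') : Primrec fun i => (c i).compConverse (c' i) := by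
  refine .pair ?_ (.pair ?_ ?_)
  · exact primrec_map (primrec_product (by fun_prop) (by fun_prop))
      (Primrec₂.natPair.comp (by fun_prop) (by fun_prop))
  · refine primrec_map (primrec_filter (primrec_product (by fun_prop) (by fun_prop))
      (primrecPred_toFinset_eq (by fun_prop) (by fun_prop))) (.pair ?_ (.pair (by fun_prop) ?_))
    · exact Primrec₂.natPair.comp (by fun_prop) (by fun_prop)
    · exact Primrec₂.natPair.comp (by fun_prop) (by fun_prop)
  · exact primrec_map (primrec_product (by fun_prop) (by fun_prop))
      (Primrec₂.natPair.comp (by fun_prop) (by fun_prop))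

theorem primrecPred_canSplit {d : ι → List (ℕ × ℕ)} {last delayed A B : ι → List ℕ}
    (hd : Primrec d) (hlast : Primrec last) (hdelayed : Primrec delayed) (hA : Primrec A)
    (hB : Primrec B) : PrimrecPred fun i => CanSplit (d i) (last i) (delayed i) (A i) (B i) := by
  refine .and ?_ (.and ?_ (.and ?_ ?_))
  · exact primrecPred_forall_mem (by fun_prop) (primrecPred_forall_mem (by fun_prop)
      ((Primrec.eq.comp (by fun_prop) (by fun_prop)).or
        (primrecPred_mem (by fun_prop) (by fun_prop)).not))
  · exact primrecPred_forall_mem (by fun_prop) (primrecPred_mem (by fun_prop) (by fun_prop))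
  · exact primrecPred_forall_mem (by fun_prop) (primrecPred_exists_mem (by fun_prop)
      (primrecPred_mem (by fun_prop) (by fun_prop)))
  · exact primrecPred_forall_mem (by fun_prop) (primrecPred_forall_mem (by fun_prop)
      (primrecPred_mem (by fun_prop) (by fun_prop)).not)

theorem primrec_splitStates {n : ι → ℕ} {Q : ι → List ℕ} (hn : Primrec n) (hQ : Primrec Q) :
    Primrec fun i => splitStates (n i) (Q i) := by
  have hsub := primrec_sublists'.comp (Primrec.list_range.comp hn)
  exact primrec_product hsub (primrec_product hsub hQ)

theorem primrec_splitCode {n : ι → ℕ} {d : ι → List (ℕ × ℕ)} {c : ι → NFACode ℕ}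
    (hn : Primrec n) (hd : Primrec d) (hc : Primrec c) :
    Primrec fun i => splitCode (n i) (d i) (c i) := by
  have hrange := Primrec.list_range.comp hn
  have hsub := primrec_sublists'.comp hrange
  refine .pair ?_ (.pair ?_ ?_)
  · exact primrec_map (by fun_prop) (Primrec.encode.comp (by fun_prop))
  · refine Primrec.list_flatMap (primrec_filter (primrec_product
      (primrec_splitStates hn (primrec_states hc)) (primrec_product hsub hsub))
        (primrecPred_canSplit (by fun_prop) (by fun_prop) (by fun_prop) (by fun_prop)
          (by fun_prop))) (primrec_map (primrec_evalList (by fun_prop)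
            (Primrec.list_cons.comp (by fun_prop) (Primrec.const [])) (primrec_filter (by fun_prop)
              (primrecPred_mem (by fun_prop) (by fun_prop)).not)) ?_)
    refine .pair (Primrec.encode.comp (by fun_prop)) (.pair (by fun_prop) (Primrec.encode.comp
      (.pair (by fun_prop) (.pair (primrec_filter (by fun_prop) ?_) (by fun_prop)))))
    exact (primrecPred_mem (by fun_prop) (by fun_prop)).or
      ((primrecPred_mem (by fun_prop) (by fun_prop)).and
        (primrecPred_mem (by fun_prop) (by fun_prop)).not)
  · exact primrec_map (primrec_splitStates hn (by fun_prop)) (Primrec.encode.comp .snd)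

theorem primrec_mulProdCode : Primrec mulProdCode :=
  primrec_compConverse (primrec_splitCode (by fun_prop) (by fun_prop) (by fun_prop))
    (primrec_compConverse (primrec_splitCode (by fun_prop) (by fun_prop) (by fun_prop))
      (by fun_prop))

end Primrec

end FoataTrace

/-- If `R` is fnf-automatic and `K`, `L` are recognizable, then `R · (K × L)` is fnf-automatic, and
there is one algorithm that, given an alphabet size, a dependence relation, and NFAs for `L_R` and
for the word languages of `K` and `L`, computes an NFA for `L_{R · (K × L)}`. -/
theorem mainTheorem6 :
    (∀ (α : Type*) [Finite α] (D : Dependence α) (R : Set (D.Trace × D.Trace))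
        (K L : Set D.Trace),
      D.IsFnfAutomatic R → D.IsRecognizable K → D.IsRecognizable L →
        D.IsFnfAutomatic (D.mulProd R K L)) ∧
    ∃ f : (ℕ × List (ℕ × ℕ)) × NFACode (List ℕ × List ℕ) × NFACode ℕ × NFACode ℕ →
        NFACode (List ℕ × List ℕ),
      Computable f ∧
      ∀ (n : ℕ) (D : Dependence (Fin n)) (d : List (ℕ × ℕ)), DescribesDependence d D →
        ∀ (R : Set (D.Trace × D.Trace)) (K L : Set D.Trace)
          (cR : NFACode (List ℕ × List ℕ)) (cK cL : NFACode ℕ),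
          cR.Presents (DescribesSets D) (D.foataLanguage R) →
          cK.Presents DescribesLetter (D.wordLanguage K) →
          cL.Presents DescribesLetter (D.wordLanguage L) →
          (f ((n, d), cR, cK, cL)).Presents (DescribesSets D)
            (D.foataLanguage (D.mulProd R K L)) := by
  refine ⟨fun _ _ _ _ _ _ => Dependence.isFnfAutomatic_mulProd, mulProdCode,
    primrec_mulProdCode.to_comp, ?_⟩
  intro n D d hd R K L cR cK cL hR hK hL
  exact presents_mulProdCode hd hR hK hL
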